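/- Let $H\in(\tfrac12,1)$ and $\theta>0$. Let $B=(B_t)_{t\ge 0}$ be a fractional Brownian motion with Hurst parameter $H$ on a probability space, i.e. a centered Gaussian process starting from zero with covariance $E(B_tB_s)=\frac12\left(t^{2H}+s^{2H}-|t-s|^{2H}\right)$ and almost surely continuous paths. Let $X=(X_t)_{t\ge0}$ be a solution of $X_0=0$, $dX_t=\theta X_t\,dt+dB_t$; that is, almost surely, the paths of $X$ are locally integrable and $X_t=\theta\int_0^tX_s\,ds+B_t$ for all $t\ge0$. For $t>0$ let $$\widehat\theta_t=\frac{\int_0^tX_s\,dX_s}{\int_0^tX_s^2\,ds},$$ where $\int_0^tX_s\,dX_s$ is a pathwise Young integral. Here, for functions $f,g$ on $[0,t]$ that are Hölder continuous of orders $\alpha,\beta\in(0,1)$ with $\alpha+\beta>1$, the Young integral $\int_0^tf_s\,dg_s$ is the limit of the Riemann–Stieltjes sums $\sum_i f_{\tau_i}(g_{u_{i+1}}-g_{u_i})$, $\tau_i\in[u_i,u_{i+1}]$, over tagged partitions of $[0,t]$ as the mesh tends to zero. Then, almost surely, for every $t>0$ the Young integral $\int_0^tX_s\,dX_s$ exists,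 $0<\int_0^tX_s^2\,ds<\infty$, and $$\widehat\theta_t=\frac{X_t^2}{2\int_0^tX_s^2\,ds};$$ moreover, almost surely, $\widehat\theta_t\to\theta$ as $t\to\infty$. -/

import Mathlib

open MeasureTheory ProbabilityTheory Filter Topology
open scoped NNReal

namespace FracOU

/-- `B` is a fractional Brownian motion with Hurst parameter `H` under `P`: a centered Gaussian
process indexed by `[0, ∞)`, starting from zero, with covariance
`E[B_t B_s] = (t^(2H) + s^(2H) - |t - s|^(2H)) / 2` and almost surely continuous paths.
Times are written as real numbers; the values of `B` at negative times play no role. -/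
structure IsFractionalBrownianMotion {Ω : Type*} [MeasurableSpace Ω]
    (H : ℝ) (B : ℝ → Ω → ℝ) (P : Measure Ω) : Prop where
  gaussian : IsGaussianProcess (fun (t : ℝ≥0) (ω : Ω) ↦ B t ω) P
  centered : ∀ t : ℝ, 0 ≤ t → ∫ ω, B t ω ∂P = 0
  covariance : ∀ s t : ℝ, 0 ≤ s → 0 ≤ t →
    ∫ ω, B t ω * B s ω ∂P = 1 / 2 * (t ^ (2 * H) + s ^ (2 * H) - |t - s| ^ (2 * H))
  start_zero : ∀ᵐ ω ∂P, B 0 ω = 0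
  continuous_paths : ∀ᵐ ω ∂P, ContinuousOn (fun t ↦ B t ω) (Set.Ici 0)

/-- `x` solves `x 0 = 0`, `dx_t = θ x_t dt + db_t` on `[0, ∞)`, in integrated form. Local
integrability makes sense of the `dt`-integral; with a continuous `b` it forces the
continuity of `x` on `[0, ∞)`. -/
structure IsOUPath (θ : ℝ) (b x : ℝ → ℝ) : Prop where
  start_zero : x 0 = 0
  integrable : ∀ t : ℝ, 0 ≤ t → IntervalIntegrable x volume 0 t
  equation : ∀ t : ℝ, 0 ≤ t → x t = θ * (∫ s in (0 : ℝ)..t, x s) + b t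

/-- `u 0 ≤ u 1 ≤ ... ≤ u n` is a partition of `[a, b]` into `n` intervals of length less
than `δ`, with a tag `τ i` in each interval `[u i, u (i + 1)]`. -/
structure IsTaggedPartition (a b δ : ℝ) (n : ℕ) (u τ : ℕ → ℝ) : Prop where
  left : u 0 = a
  right : u n = b
  tag_mem : ∀ i < n, τ i ∈ Set.Icc (u i) (u (i + 1))
  mesh : ∀ i < n, u (i + 1) - u i < δ

/-- `I` is the Riemann-Stieltjes integral of `f` against `g` over `[a, b]`: the limit of the
sums `∑ f (τ i) (g (u (i + 1)) - g (u i))` over all tagged partitions, as the mesh tends to 0. -/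
def HasRiemannStieltjesIntegral (f g : ℝ → ℝ) (a b I : ℝ) : Prop :=
  a ≤ b ∧ ∀ ε > 0, ∃ δ > 0, ∀ (n : ℕ) (u τ : ℕ → ℝ), IsTaggedPartition a b δ n u τ →
    |∑ i ∈ Finset.range n, f (τ i) * (g (u (i + 1)) - g (u i)) - I| < ε

/-- `I` is the Young integral of `f` against `g` over `[a, b]`: on `[a, b]` the functions are
Hölder continuous of orders `α, β ∈ (0, 1)` with `α + β > 1`, and `I` is their
Riemann-Stieltjes integral. -/
def HasYoungIntegral (f g : ℝ → ℝ) (a b I : ℝ) : Prop :=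
  (∃ α β C D : ℝ≥0, 0 < α ∧ α < 1 ∧ 0 < β ∧ β < 1 ∧ 1 < α + β ∧
    HolderOnWith C α f (Set.Icc a b) ∧ HolderOnWith D β g (Set.Icc a b)) ∧
  HasRiemannStieltjesIntegral f g a b I

/-- There are tagged partitions of arbitrarily small mesh. -/
theorem exists_isTaggedPartition {a b δ : ℝ} (hab : a ≤ b) (hδ : 0 < δ) :
    ∃ n u τ, IsTaggedPartition a b δ n u τ := by
  obtain ⟨n, hn⟩ := exists_nat_gt ((b - a) / δ)
  have hn0 : (0 : ℝ) < n := lt_of_le_of_lt (div_nonneg (by linarith) hδ.le) hn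
  have hstep : (b - a) / n < δ := by
    rw [div_lt_iff₀ hδ] at hn
    rw [div_lt_iff₀ hn0]
    linarith
  have hstep0 : 0 ≤ (b - a) / n := div_nonneg (by linarith) hn0.le
  refine ⟨n, fun i ↦ a + i * ((b - a) / n), fun i ↦ a + i * ((b - a) / n),
    by simp, ?_, fun i _ ↦ ⟨le_rfl, ?_⟩, fun i _ ↦ ?_⟩
  · field_simp
    ring
  · push_cast
    nlinarith
  · push_cast
    nlinarith

/-- The Riemann-Stieltjes integral is unique, hence so is the Young integral. -/
theorem HasRiemannStieltjesIntegral.unique {f g : ℝ → ℝ} {a b I J : ℝ}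
    (hI : HasRiemannStieltjesIntegral f g a b I) (hJ : HasRiemannStieltjesIntegral f g a b J) :
    I = J := by
  by_contra hne
  have hpos : 0 < |I - J| / 2 := by
    have := abs_pos.2 (sub_ne_zero.2 hne)
    linarith
  obtain ⟨δ₁, hδ₁, h₁⟩ := hI.2 _ hpos
  obtain ⟨δ₂, hδ₂, h₂⟩ := hJ.2 _ hpos
  obtain ⟨n, u, τ, h⟩ := exists_isTaggedPartition hI.1 (lt_min hδ₁ hδ₂)
  have k₁ := h₁ n u τ ⟨h.left, h.right, h.tag_mem,
    fun i hi ↦ (h.mesh i hi).trans_le (min_le_left _ _)⟩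
  have k₂ := h₂ n u τ ⟨h.left, h.right, h.tag_mem,
    fun i hi ↦ (h.mesh i hi).trans_le (min_le_right _ _)⟩
  rw [abs_lt] at k₁ k₂
  have : |I - J| < |I - J| := by
    rw [abs_lt]
    constructor <;> linarith
  exact lt_irrefl _ this

open scoped Classical in
/-- The Young integral of `f` against `g` over `[a, b]` (and `0` if it does not exist). -/
noncomputable def youngIntegral (f g : ℝ → ℝ) (a b : ℝ) : ℝ :=
  if h : ∃ I, HasYoungIntegral f g a b I then h.choose else 0

/-- The least squares estimator `(∫₀ᵗ x dx) / (∫₀ᵗ x² ds)` computed from the path `x` on `[0, t]`,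
the numerator being a Young integral. -/
noncomputable def leastSquaresEstimator (x : ℝ → ℝ) (t : ℝ) : ℝ :=
  youngIntegral x x 0 t / ∫ s in (0 : ℝ)..t, x s ^ 2

end FracOU

namespace FracOU

/-! Everything is deterministic once a path `b` of the noise has three properties, collected in
`IsOUPath.leastSquaresEstimator_spec`: Hölder continuity of some order `γ ∈ (1/2, 1)` with constants
growing polynomially in time, nonvanishing at the times `1 / (n + 1)`, and `ξ = ∫₀^∞ e^(-θs) b_s ds
≠ 0`.

The path `x` inherits the Hölder order `γ > 1/2`, so the ordinary chain rule gives `∫₀ᵗ x dx = x_t²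
/ 2` (`hasYoungIntegral_self`). Solving the equation gives `e^(-θt) x_t = θ ∫₀ᵗ e^(-θs) b_s ds +
e^(-θt) b_t`, which tends to `L = θ ξ` because `b` grows at most cubically. As `L ≠ 0`, `x_t²`
behaves like `L² e^(2θt)` and `∫₀ᵗ x²` like `L² e^(2θt) / (2θ)`, so the quotient tends to `θ`.

The probabilistic input is a Kolmogorov-type estimate (`ae_exists_local_holder`) and the fact that
`ξ` has no atom at `0` (`ae_integral_exp_mul_ne_zero`). For the latter, `ξ` is a limit of positively
weighted sums of values of `B`. Covariances at nonnegative times are nonnegative, so the variances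
of these Gaussian sums stay bounded below. The resulting small ball bounds are uniform and survive
the limit. -/

/-! ### Dyadic chaining, and growth and Hölder bounds from local ones -/

theorem abs_sub_dyadic_floor_succ_le {f : ℝ → ℝ} {a M r : ℝ} (hM : 0 ≤ M) (hr0 : 0 < r)
    (hr1 : r < 1)
    (h : ∀ n k : ℕ, k < 2 ^ n → |f (a + (k + 1) / 2 ^ n) - f (a + k / 2 ^ n)| ≤ M * r ^ n)
    {x : ℝ} (hx0 : 0 ≤ x) (hx1 : x ≤ 1) (n : ℕ) :
    |f (a + ⌊2 ^ (n + 1) * x⌋₊ / 2 ^ (n + 1)) - f (a + ⌊2 ^ n * x⌋₊ / 2 ^ n)| ≤ M * r ^ n := by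
  have h2 : (0 : ℝ) < 2 ^ n := by positivity
  have hy0 : 0 ≤ 2 ^ n * x := by positivity
  have hz0 : 0 ≤ 2 ^ (n + 1) * x := by positivity
  have hyz : (2 : ℝ) ^ (n + 1) * x = 2 * (2 ^ n * x) := by ring
  set k := ⌊2 ^ n * x⌋₊ with hk
  set l := ⌊2 ^ (n + 1) * x⌋₊ with hl
  have k1 := Nat.floor_le hy0
  have k2 := Nat.lt_floor_add_one (2 ^ n * x)
  have l1 := Nat.floor_le hz0
  have l2 := Nat.lt_floor_add_one (2 ^ (n + 1) * x)
  rw [← hk] at k1 k2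
  rw [← hl] at l1 l2
  -- The floor of `2y` is twice the floor of `y` or one more, so refining by one level either stays
  -- put or moves by one step of the finer grid.
  have hlk : l = 2 * k ∨ l = 2 * k + 1 := by
    have h1 : 2 * k < l + 1 := by
      have : (2 * k : ℝ) < l + 1 := by linarith
      exact_mod_cast this
    have h3 : l < 2 * k + 2 := by
      have : (l : ℝ) < 2 * k + 2 := by linarith
      exact_mod_cast this
    omega
  have heq : (k : ℝ) / 2 ^ n = (2 * k : ℕ) / 2 ^ (n + 1) := by
    push_cast
    field_simp
    ring
  rcases hlk with h' | h'
  · rw [h', heq]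
    simp only [sub_self, abs_zero]
    positivity
  · have hlt : 2 * k < 2 ^ (n + 1) := by
      have : (2 * k + 1 : ℝ) ≤ 2 ^ (n + 1) := by
        have h4 : (l : ℝ) = 2 * k + 1 := by rw [h']; push_cast; ring
        have h5 : (2 : ℝ) ^ (n + 1) * x ≤ 2 ^ (n + 1) := by
          have : (0 : ℝ) < 2 ^ (n + 1) := by positivity
          nlinarith
        linarith
      have h6 : 2 * k + 1 ≤ 2 ^ (n + 1) := by exact_mod_cast this
      omega
    have h7 := h (n + 1) (2 * k) hlt
    rw [h', heq]
    have h8 : ((2 * k + 1 : ℕ) : ℝ) = ((2 * k : ℕ) : ℝ) + 1 := by push_cast; ring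
    rw [h8]
    refine h7.trans (mul_le_mul_of_nonneg_left ?_ hM)
    exact pow_le_pow_of_le_one hr0.le hr1.le (Nat.le_succ n)

/-- The dyadic approximations from below converge to `x`, so by continuity the increments between
successive levels telescope to the limit; the bound is the tail of a geometric series. -/
theorem abs_sub_dyadic_floor_le {f : ℝ → ℝ} {a M r : ℝ} (hM : 0 ≤ M) (hr0 : 0 < r)
    (hr1 : r < 1) (hf : ContinuousOn f (Set.Icc a (a + 1)))
    (h : ∀ n k : ℕ, k < 2 ^ n → |f (a + (k + 1) / 2 ^ n) - f (a + k / 2 ^ n)| ≤ M * r ^ n)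
    {x : ℝ} (hx0 : 0 ≤ x) (hx1 : x ≤ 1) (n : ℕ) :
    |f (a + ⌊2 ^ n * x⌋₊ / 2 ^ n) - f (a + x)| ≤ M * r ^ n / (1 - r) := by
  have hmem : ∀ n : ℕ, (⌊2 ^ n * x⌋₊ : ℝ) / 2 ^ n ≤ x := fun n ↦ by
    rw [div_le_iff₀ (by positivity), mul_comm]
    exact Nat.floor_le (by positivity)
  have hlim : Tendsto (fun n : ℕ ↦ a + (⌊2 ^ n * x⌋₊ : ℝ) / 2 ^ n) atTop (𝓝 (a + x)) := by
    refine tendsto_const_nhds.add ?_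
    have h1 : Tendsto (fun n : ℕ ↦ x - (1 / 2 : ℝ) ^ n) atTop (𝓝 x) := by
      simpa using tendsto_const_nhds.sub
        (tendsto_pow_atTop_nhds_zero_of_lt_one (r := (1 / 2 : ℝ)) (by norm_num) (by norm_num))
    refine tendsto_of_tendsto_of_tendsto_of_le_of_le h1 tendsto_const_nhds (fun n ↦ ?_) hmem
    have h2 := (Nat.lt_floor_add_one (2 ^ n * x)).le
    have h3 : (0 : ℝ) < 2 ^ n := by positivity
    rw [le_div_iff₀ h3, sub_mul, ← mul_pow]
    norm_num
    linarith
  have hlim' : Tendsto (fun n : ℕ ↦ f (a + (⌊2 ^ n * x⌋₊ : ℝ) / 2 ^ n)) atTop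
      (𝓝 (f (a + x))) := by
    refine ((hf (a + x) ⟨by linarith, by linarith⟩).tendsto).comp ?_
    refine tendsto_nhdsWithin_iff.2 ⟨hlim, Eventually.of_forall fun n ↦ ⟨?_, ?_⟩⟩
    · have : (0 : ℝ) ≤ (⌊2 ^ n * x⌋₊ : ℝ) / 2 ^ n := by positivity
      linarith
    · have := hmem n
      linarith
  refine dist_le_of_le_geometric_of_tendsto r M hr1 (fun n ↦ ?_) hlim' n
  rw [dist_comm]
  exact abs_sub_dyadic_floor_succ_le hM hr0 hr1 h hx0 hx1 n

/-- Dyadic chaining: geometric bounds on dyadic increments give a Hölder bound. -/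
theorem abs_sub_le_of_dyadic {γ : ℝ} (hγ : 0 < γ) :
    ∃ C : ℝ, 0 ≤ C ∧ ∀ (f : ℝ → ℝ) (a M : ℝ), 0 ≤ M → ContinuousOn f (Set.Icc a (a + 1)) →
      (∀ n k : ℕ, k < 2 ^ n →
        |f (a + (k + 1) / 2 ^ n) - f (a + k / 2 ^ n)| ≤ M * ((2 : ℝ) ^ (-γ)) ^ n) →
      ∀ s ∈ Set.Icc a (a + 1), ∀ t ∈ Set.Icc a (a + 1), |f t - f s| ≤ C * M * |t - s| ^ γ := by
  set r : ℝ := (2 : ℝ) ^ (-γ) with hr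
  have hr0 : 0 < r := by positivity
  have hr1 : r < 1 := Real.rpow_lt_one_of_one_lt_of_neg (by norm_num) (by linarith)
  have h1r : 0 < 1 - r := by linarith
  -- Two geometric tails, one at each endpoint, plus one step between neighbouring grid points; `2 ^
  -- γ` pays for rounding `t - s` up to a power of `1 / 2`.
  refine ⟨(2 / (1 - r) + 1) * 2 ^ γ, by positivity, fun f a M hM hf h ↦ ?_⟩
  have key : ∀ s ∈ Set.Icc a (a + 1), ∀ t ∈ Set.Icc a (a + 1), s < t →
      |f t - f s| ≤ (2 / (1 - r) + 1) * 2 ^ γ * M * |t - s| ^ γ := by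
    intro s hs t ht hst
    -- With `2^(-n-1) < t - s ≤ 2^(-n)`, the level-`n` floors of `s` and `t` coincide or are
    -- adjacent.
    obtain ⟨n, hn1, hn2⟩ := exists_nat_pow_near_of_lt_one (x := t - s) (y := (1 / 2 : ℝ))
      (by linarith) (by linarith [ht.2, hs.1]) (by norm_num) (by norm_num)
    have hs' := abs_sub_dyadic_floor_le hM hr0 hr1 hf h (x := s - a) (by linarith [hs.1])
      (by linarith [hs.2]) n
    have ht' := abs_sub_dyadic_floor_le hM hr0 hr1 hf h (x := t - a) (by linarith [ht.1])
      (by linarith [ht.2]) n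
    rw [add_sub_cancel] at hs' ht'
    have hp : (0 : ℝ) < 2 ^ n := by positivity
    set k := ⌊2 ^ n * (s - a)⌋₊ with hk
    set l := ⌊2 ^ n * (t - a)⌋₊ with hl
    have hkl : k ≤ l := Nat.floor_le_floor (mul_le_mul_of_nonneg_left (by linarith) hp.le)
    have hlk : l ≤ k + 1 := by
      have h1 := Nat.lt_floor_add_one (2 ^ n * (s - a))
      have h2 := Nat.floor_le (a := 2 ^ n * (t - a))
        (mul_nonneg hp.le (by linarith [ht.1]))
      rw [← hk] at h1
      rw [← hl] at h2
      have h3 : 2 ^ n * (t - s) ≤ 1 := by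
        calc 2 ^ n * (t - s) ≤ 2 ^ n * (1 / 2) ^ n := mul_le_mul_of_nonneg_left hn2 hp.le
          _ = 1 := by rw [← mul_pow]; norm_num
      have h4 : (l : ℝ) < k + 2 := by nlinarith
      have : l < k + 2 := by exact_mod_cast h4
      omega
    have hmid : |f (a + l / 2 ^ n) - f (a + k / 2 ^ n)| ≤ M * r ^ n := by
      rcases Nat.eq_or_lt_of_le hkl with h' | h'
      · rw [← h']
        simp only [sub_self, abs_zero]
        positivity
      · have h1 : l = k + 1 := by omega
        have h2 : k < 2 ^ n := by
          have h3 := Nat.floor_le (a := 2 ^ n * (t - a))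
            (mul_nonneg hp.le (by linarith [ht.1]))
          rw [← hl, h1] at h3
          push_cast at h3
          have h4 : (k : ℝ) < 2 ^ n := by nlinarith [ht.2]
          exact_mod_cast h4
        have := h n k h2
        rw [h1]
        push_cast
        exact this
    have hrn : r ^ n ≤ 2 ^ γ * |t - s| ^ γ := by
      rw [abs_of_pos (by linarith), ← Real.mul_rpow (by norm_num) (by linarith)]
      have h1 : r ^ n = ((1 / 2 : ℝ) ^ n) ^ γ := by
        rw [hr, ← Real.rpow_natCast, ← Real.rpow_mul (by norm_num), ← Real.rpow_natCast,
          ← Real.rpow_mul (by norm_num), one_div, Real.inv_rpow (by norm_num),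
          ← Real.rpow_neg (by norm_num)]
        congr 1
        ring
      rw [h1]
      refine Real.rpow_le_rpow (by positivity) ?_ hγ.le
      rw [pow_succ] at hn1
      linarith
    calc |f t - f s| ≤ M * r ^ n / (1 - r) + M * r ^ n + M * r ^ n / (1 - r) := by
          rw [abs_le] at hs' ht' hmid ⊢
          constructor <;> linarith
      _ = (2 / (1 - r) + 1) * M * r ^ n := by ring
      _ ≤ (2 / (1 - r) + 1) * M * (2 ^ γ * |t - s| ^ γ) := by gcongr
      _ = _ := by ring
  intro s hs t ht
  rcases lt_trichotomy s t with h' | h' | h'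
  · exact key s hs t ht h'
  · subst h'
    simp [Real.zero_rpow hγ.ne']
  · rw [abs_sub_comm (f t), abs_sub_comm t]
    exact key t ht s hs h'

/-- A function with Hölder constants `A (j + 1)²` on the intervals `[j, j + 1]` grows at most
like `t³`. -/
theorem abs_le_of_local_holder {f : ℝ → ℝ} {γ A : ℝ} (hγ : 0 < γ) (hA : 0 ≤ A) (h0 : f 0 = 0)
    (h : ∀ j : ℕ, ∀ s ∈ Set.Icc (j : ℝ) (j + 1), ∀ t ∈ Set.Icc (j : ℝ) (j + 1),
      |f t - f s| ≤ A * (j + 1) ^ 2 * |t - s| ^ γ) {t : ℝ} (ht : 0 ≤ t) :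
    |f t| ≤ A * (t + 1) ^ 3 := by
  have hone : ∀ j : ℕ, ∀ t ∈ Set.Icc (j : ℝ) (j + 1), |f t - f j| ≤ A * (j + 1) ^ 2 := by
    intro j t ht
    refine (h j j ⟨le_rfl, by linarith⟩ t ht).trans ?_
    have h1 : |t - j| ^ γ ≤ 1 := by
      refine Real.rpow_le_one (abs_nonneg _) ?_ hγ.le
      rw [abs_le]
      constructor <;> linarith [ht.1, ht.2]
    exact mul_le_of_le_one_right (by positivity) h1
  have hnat : ∀ j : ℕ, |f j| ≤ A * j ^ 3 := by
    intro j
    induction j with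
    | zero => simp [h0]
    | succ j ih =>
      have h1 := hone j (j + 1) ⟨by linarith, le_rfl⟩
      push_cast
      have h2 : A * (j : ℝ) ^ 3 + A * (j + 1) ^ 2 ≤ A * (j + 1) ^ 3 := by
        rw [← mul_add]
        refine mul_le_mul_of_nonneg_left ?_ hA
        have : (0 : ℝ) ≤ j := by positivity
        nlinarith [mul_nonneg this this]
      rw [abs_le] at *
      constructor <;> linarith
  have h1 := hone ⌊t⌋₊ t ⟨Nat.floor_le ht, (Nat.lt_floor_add_one t).le⟩
  have h2 := hnat ⌊t⌋₊
  have h3 : A * (⌊t⌋₊ : ℝ) ^ 3 + A * (⌊t⌋₊ + 1) ^ 2 ≤ A * (⌊t⌋₊ + 1) ^ 3 := by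
    rw [← mul_add]
    refine mul_le_mul_of_nonneg_left ?_ hA
    have : (0 : ℝ) ≤ ⌊t⌋₊ := by positivity
    nlinarith [mul_nonneg this this]
  have h4 : A * ((⌊t⌋₊ : ℝ) + 1) ^ 3 ≤ A * (t + 1) ^ 3 := by
    have := Nat.floor_le ht
    gcongr
  have h5 := abs_sub_abs_le_abs_sub (f t) (f ⌊t⌋₊)
  linarith

/-- Across an integer the increment splits into two, each over a shorter interval, so the constants
at worst add up. -/
theorem exists_holder_Icc_of_local {f : ℝ → ℝ} {γ : ℝ} (hγ : 0 < γ) {K : ℕ → ℝ}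
    (hK : ∀ j, 0 ≤ K j)
    (h : ∀ j : ℕ, ∀ s ∈ Set.Icc (j : ℝ) (j + 1), ∀ t ∈ Set.Icc (j : ℝ) (j + 1),
      |f t - f s| ≤ K j * |t - s| ^ γ) (n : ℕ) :
    ∃ D : ℝ, 0 ≤ D ∧ ∀ s t : ℝ, 0 ≤ s → s ≤ t → t ≤ n → |f t - f s| ≤ D * |t - s| ^ γ := by
  induction n with
  | zero =>
    refine ⟨0, le_rfl, fun s t hs hst ht ↦ ?_⟩
    have : s = t := by
      push_cast at ht
      linarith
    simp [this]
  | succ n ih =>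
    obtain ⟨D, hD, hDh⟩ := ih
    refine ⟨D + K n, add_nonneg hD (hK n), fun s t hs hst ht ↦ ?_⟩
    push_cast at ht
    have hpow : 0 ≤ |t - s| ^ γ := by positivity
    rcases le_total t n with h1 | h1
    · refine (hDh s t hs hst h1).trans ?_
      nlinarith [hK n]
    rcases le_total (n : ℝ) s with h2 | h2
    · refine (h n s ⟨h2, by linarith⟩ t ⟨h1, ht⟩).trans ?_
      nlinarith
    have e1 := hDh s n hs h2 le_rfl
    have e2 := h n n ⟨le_rfl, by linarith⟩ t ⟨h1, ht⟩
    have m1 : |(n : ℝ) - s| ^ γ ≤ |t - s| ^ γ := by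
      rw [abs_of_nonneg (by linarith), abs_of_nonneg (by linarith)]
      exact Real.rpow_le_rpow (by linarith) (by linarith) hγ.le
    have m2 : |t - (n : ℝ)| ^ γ ≤ |t - s| ^ γ := by
      rw [abs_of_nonneg (by linarith), abs_of_nonneg (by linarith)]
      exact Real.rpow_le_rpow (by linarith) (by linarith) hγ.le
    have e3 := abs_sub_le (f t) (f n) (f s)
    have e4 := mul_le_mul_of_nonneg_left m1 hD
    have e5 := mul_le_mul_of_nonneg_left m2 (hK n)
    linarith

/-! ### Regularity of the solution and its Young integral against itself -/

theorem IsOUPath.continuousOn {θ : ℝ} {b x : ℝ → ℝ} (hx : IsOUPath θ b x)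
    (hb : ContinuousOn b (Set.Ici 0)) : ContinuousOn x (Set.Ici 0) := by
  have hprim : ContinuousOn (fun t ↦ ∫ s in (0 : ℝ)..t, x s) (Set.Ici 0) := by
    intro t (ht : 0 ≤ t)
    have h1 := intervalIntegral.continuousOn_primitive_interval'
      (hx.integrable (t + 1) (by linarith)) (a := 0) Set.left_mem_uIcc
    rw [Set.uIcc_of_le (by linarith)] at h1
    refine (h1 t ⟨ht, by linarith⟩).mono_of_mem_nhdsWithin ?_
    rw [← Set.Ici_inter_Iic]
    exact inter_mem_nhdsWithin _ (Iic_mem_nhds (by linarith))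
  exact ((continuousOn_const.mul hprim).add hb).congr fun t ht ↦ hx.equation t ht

/-- The drift is Lipschitz on `[0, T]` because `x` is bounded there, and on a bounded interval
Lipschitz implies Hölder of order `γ < 1`; the noise contributes its own constant. -/
theorem IsOUPath.exists_holder {θ γ : ℝ} {b x : ℝ → ℝ} (hx : IsOUPath θ b x)
    (hγ1 : γ < 1) (hb : ContinuousOn b (Set.Ici 0)) {T D : ℝ} (hD : 0 ≤ D)
    (hbD : ∀ s t : ℝ, 0 ≤ s → s ≤ t → t ≤ T → |b t - b s| ≤ D * |t - s| ^ γ) :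
    ∃ K : ℝ, 0 ≤ K ∧ ∀ s t : ℝ, 0 ≤ s → s ≤ t → t ≤ T → |x t - x s| ≤ K * |t - s| ^ γ := by
  obtain ⟨M, hM⟩ := isCompact_Icc.exists_bound_of_continuousOn
    ((hx.continuousOn hb).mono (Set.Icc_subset_Ici_self : Set.Icc 0 T ⊆ Set.Ici 0))
  refine ⟨|θ| * (|M| * |T| ^ (1 - γ)) + D, by positivity, fun s t hs hst ht ↦ ?_⟩
  have hint : |∫ u in s..t, x u| ≤ |M| * |T| ^ (1 - γ) * |t - s| ^ γ := by
    have h1 : ‖∫ u in s..t, x u‖ ≤ |M| * |t - s| := by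
      refine intervalIntegral.norm_integral_le_of_norm_le_const fun u hu ↦ ?_
      rw [Set.uIoc_of_le hst] at hu
      exact (hM u ⟨by linarith [hu.1], by linarith [hu.2]⟩).trans (le_abs_self M)
    rw [Real.norm_eq_abs] at h1
    refine h1.trans ?_
    rw [mul_assoc]
    refine mul_le_mul_of_nonneg_left ?_ (abs_nonneg M)
    rcases hst.eq_or_lt with h2 | h2
    · rw [h2]
      simp only [sub_self, abs_zero]
      positivity
    · have h3 : 0 < |t - s| := abs_pos.2 (by linarith)
      have h4 : |t - s| = |t - s| ^ (1 - γ) * |t - s| ^ γ := by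
        rw [← Real.rpow_add h3]
        simp
      calc |t - s| = |t - s| ^ (1 - γ) * |t - s| ^ γ := h4
        _ ≤ |T| ^ (1 - γ) * |t - s| ^ γ := by
          refine mul_le_mul_of_nonneg_right ?_ (by positivity)
          refine Real.rpow_le_rpow (abs_nonneg _) ?_ (by linarith)
          rw [abs_of_pos (by linarith : 0 < t - s), abs_of_nonneg (by linarith)]
          linarith
  have hdiff : x t - x s = θ * (∫ u in s..t, x u) + (b t - b s) := by
    rw [hx.equation t (by linarith), hx.equation s hs,
      ← intervalIntegral.integral_interval_sub_left (hx.integrable t (by linarith))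
        (hx.integrable s hs)]
    ring
  rw [hdiff]
  refine (abs_add_le _ _).trans ?_
  rw [abs_mul]
  have h5 := mul_le_mul_of_nonneg_left hint (abs_nonneg θ)
  have h6 := hbD s t hs hst ht
  linarith

/-- For a Hölder continuous function of order `γ > 1/2`, `∫ x dx = (x(t)² - x(0)²) / 2`. -/
theorem hasYoungIntegral_self {x : ℝ → ℝ} {γ K t : ℝ} (hγ : 1 / 2 < γ) (hγ1 : γ < 1)
    (hK : 0 ≤ K) (ht : 0 ≤ t)
    (h : ∀ s u : ℝ, 0 ≤ s → s ≤ u → u ≤ t → |x u - x s| ≤ K * |u - s| ^ γ) :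
    HasYoungIntegral x x 0 t ((x t ^ 2 - x 0 ^ 2) / 2) := by
  have h' : ∀ s ∈ Set.Icc 0 t, ∀ u ∈ Set.Icc 0 t, |x s - x u| ≤ K * |s - u| ^ γ := by
    intro s hs u hu
    rcases le_total s u with h1 | h1
    · rw [abs_sub_comm (x s), abs_sub_comm s]
      exact h s u hs.1 h1 hu.2
    · exact h u s hu.1 h1 hs.2
  obtain ⟨γ', hγ'⟩ : ∃ γ' : ℝ≥0, (γ' : ℝ) = γ := ⟨γ.toNNReal, Real.coe_toNNReal _ (by linarith)⟩
  have hhol : HolderOnWith K.toNNReal γ' x (Set.Icc 0 t) := by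
    intro s hs u hu
    rw [edist_dist, edist_dist, hγ', ENNReal.ofReal_rpow_of_nonneg dist_nonneg (by linarith),
      ENNReal.ofNNReal_toNNReal, ← ENNReal.ofReal_mul hK]
    exact ENNReal.ofReal_le_ofReal (h' s hs u hu)
  have hγ0 : 0 < γ' := NNReal.coe_pos.1 (by linarith)
  have hγ'1 : γ' < 1 := NNReal.coe_lt_coe.1 (by rw [hγ']; simpa using hγ1)
  have hγ2 : 1 < γ' + γ' := NNReal.coe_lt_coe.1 (by
    rw [NNReal.coe_add, hγ', NNReal.coe_one]
    linarith)
  refine ⟨⟨γ', γ', _, _, hγ0, hγ'1, hγ0, hγ'1, hγ2, hhol, hhol⟩, ht, ?_⟩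
  intro ε hε
  -- The excess of `2γ` over `1`: the total error is at most `K² δ^q t`, which vanishes with the
  -- mesh exactly because `γ > 1/2`.
  set q : ℝ := 2 * γ - 1 with hq
  have hq0 : 0 < q := by rw [hq]; linarith
  have hlim : Tendsto (fun δ : ℝ ↦ K ^ 2 * δ ^ q * t) (𝓝[>] 0) (𝓝 0) := by
    have h1 : Tendsto (fun δ : ℝ ↦ δ ^ q) (𝓝[>] 0) (𝓝 0) := by
      have := (Real.continuousAt_rpow_const 0 q (Or.inr hq0.le)).tendsto
      rw [Real.zero_rpow hq0.ne'] at this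
      exact this.mono_left nhdsWithin_le_nhds
    simpa using (h1.const_mul (K ^ 2)).mul_const t
  obtain ⟨δ, hδε, hδ⟩ := ((hlim.eventually (gt_mem_nhds hε)).and self_mem_nhdsWithin).exists
  replace hδ : 0 < δ := hδ
  refine ⟨δ, hδ, fun n u τ hP ↦ lt_of_le_of_lt ?_ hδε⟩
  have hmono : ∀ i < n, u i ≤ u (i + 1) := fun i hi ↦
    (hP.tag_mem i hi).1.trans (hP.tag_mem i hi).2
  have hle : ∀ i ≤ n, 0 ≤ u i := by
    intro i
    induction i with
    | zero => intro _; rw [hP.left]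
    | succ i ih => intro hi; exact (ih (by omega)).trans (hmono i (by omega))
  have hge : ∀ i ≤ n, u i ≤ t := by
    intro i hi
    induction hi using Nat.decreasingInduction with
    | self => rw [hP.right]
    | of_succ i hi ih => exact (hmono i hi).trans ih
  have htel : ∑ i ∈ Finset.range n, (x (u (i + 1)) ^ 2 / 2 - x (u i) ^ 2 / 2)
      = (x t ^ 2 - x 0 ^ 2) / 2 := by
    rw [Finset.sum_range_sub (fun i ↦ x (u i) ^ 2 / 2), hP.left, hP.right]
    ring
  rw [← htel, ← Finset.sum_sub_distrib]
  have htel2 : ∑ i ∈ Finset.range n, (u (i + 1) - u i) = t := by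
    rw [Finset.sum_range_sub u, hP.left, hP.right, sub_zero]
  calc _ ≤ ∑ i ∈ Finset.range n, |x (τ i) * (x (u (i + 1)) - x (u i))
        - (x (u (i + 1)) ^ 2 / 2 - x (u i) ^ 2 / 2)| := Finset.abs_sum_le_sum_abs _ _
    _ ≤ ∑ i ∈ Finset.range n, K ^ 2 * δ ^ q * (u (i + 1) - u i) := by
      refine Finset.sum_le_sum fun i hi ↦ ?_
      rw [Finset.mem_range] at hi
      have i1 : u i ∈ Set.Icc 0 t := ⟨hle i hi.le, hge i hi.le⟩
      have i2 : u (i + 1) ∈ Set.Icc 0 t := ⟨hle _ hi, hge _ hi⟩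
      have i3 : τ i ∈ Set.Icc 0 t :=
        ⟨i1.1.trans (hP.tag_mem i hi).1, (hP.tag_mem i hi).2.trans i2.2⟩
      set d := u (i + 1) - u i with hd
      have hd0 : 0 ≤ d := sub_nonneg.2 (hmono i hi)
      have b1 : |x (τ i) - x (u i)| ≤ K * d ^ γ := by
        refine (h' _ i3 _ i1).trans ?_
        have := hP.tag_mem i hi
        rw [abs_of_nonneg (by linarith [this.1])]
        refine mul_le_mul_of_nonneg_left ?_ hK
        exact Real.rpow_le_rpow (by linarith [this.1]) (by linarith [this.2]) (by linarith)
      have b2 : |x (τ i) - x (u (i + 1))| ≤ K * d ^ γ := by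
        refine (h' _ i3 _ i2).trans ?_
        have := hP.tag_mem i hi
        rw [abs_of_nonpos (by linarith [this.2])]
        refine mul_le_mul_of_nonneg_left ?_ hK
        exact Real.rpow_le_rpow (by linarith [this.2]) (by linarith [this.1]) (by linarith)
      have b3 : |x (u (i + 1)) - x (u i)| ≤ K * d ^ γ := by
        refine (h' _ i2 _ i1).trans ?_
        rw [← hd, abs_of_nonneg hd0]
      -- Compared with the telescoping increment of `x² / 2`, the summand differs by a product of
      -- two increments of `x`, hence by a term of order `d ^ (2γ)`, for any tag.
      have e1 : x (τ i) * (x (u (i + 1)) - x (u i)) - (x (u (i + 1)) ^ 2 / 2 - x (u i) ^ 2 / 2)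
          = (((x (τ i) - x (u i)) + (x (τ i) - x (u (i + 1)))) / 2)
            * (x (u (i + 1)) - x (u i)) := by ring
      rw [e1, abs_mul]
      have b4 : |((x (τ i) - x (u i)) + (x (τ i) - x (u (i + 1)))) / 2| ≤ K * d ^ γ := by
        rw [abs_le] at *
        constructor <;> linarith
      refine (mul_le_mul b4 b3 (abs_nonneg _) (by positivity)).trans ?_
      have e2 : K * d ^ γ * (K * d ^ γ) = K ^ 2 * (d ^ γ * d ^ γ) := by ring
      rw [e2, mul_assoc]
      refine mul_le_mul_of_nonneg_left ?_ (by positivity)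
      rcases hd0.eq_or_lt with h0 | h0
      · rw [← h0, Real.zero_rpow (by linarith)]
        simp
      · have e3 : d ^ γ * d ^ γ = d ^ q * d := by
          rw [← Real.rpow_add h0, ← Real.rpow_add_one h0.ne']
          congr 1
          rw [hq]
          ring
        rw [e3]
        refine mul_le_mul_of_nonneg_right ?_ hd0
        exact Real.rpow_le_rpow hd0 (hP.mesh i hi).le hq0.le
    _ = K ^ 2 * δ ^ q * t := by rw [← Finset.mul_sum, htel2]

theorem youngIntegral_eq {f g : ℝ → ℝ} {a b I : ℝ} (h : HasYoungIntegral f g a b I) :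
    youngIntegral f g a b = I := by
  have hex : ∃ I, HasYoungIntegral f g a b I := ⟨I, h⟩
  rw [youngIntegral, dif_pos hex]
  exact hex.choose_spec.2.unique h.2

/-! ### Long-time behaviour of a single path -/

/-- Variation of constants for the primitive `y` of `x`, which satisfies `y' = θ y + b`. Unlike `x`,
it is differentiable, so no integral against the rough `b` is needed. -/
theorem IsOUPath.exp_mul_integral {θ : ℝ} {b x : ℝ → ℝ} (hx : IsOUPath θ b x)
    (hb : ContinuousOn b (Set.Ici 0)) {t : ℝ} (ht : 0 ≤ t) :
    Real.exp (-θ * t) * ∫ s in (0 : ℝ)..t, x s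
      = ∫ s in (0 : ℝ)..t, Real.exp (-θ * s) * b s := by
  have hxc := hx.continuousOn hb
  have hexp : Continuous fun s : ℝ ↦ Real.exp (-θ * s) := by fun_prop
  have hprim := intervalIntegral.continuousOn_primitive_interval' (hx.integrable t ht) (a := 0)
    Set.left_mem_uIcc
  rw [Set.uIcc_of_le ht] at hprim
  have hFTC := intervalIntegral.integral_eq_sub_of_hasDerivAt_of_le ht
    (f := fun s ↦ Real.exp (-θ * s) * ∫ u in (0 : ℝ)..s, x u)
    (f' := fun s ↦ Real.exp (-θ * s) * b s) (hexp.continuousOn.mul hprim) ?_ ?_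
  · rw [hFTC]
    simp
  · intro s hs
    have h1 : HasDerivAt (fun s ↦ ∫ u in (0 : ℝ)..s, x u) (x s) s := by
      refine intervalIntegral.integral_hasDerivAt_right (hx.integrable s hs.1.le) ?_
        (hxc.continuousAt (Ici_mem_nhds hs.1))
      exact (hxc.mono Set.Ioi_subset_Ici_self).stronglyMeasurableAtFilter isOpen_Ioi s hs.1
    have h2 : HasDerivAt (fun s : ℝ ↦ Real.exp (-θ * s)) (Real.exp (-θ * s) * (-θ * 1)) s :=
      ((hasDerivAt_id s).const_mul (-θ)).exp
    refine (h2.mul h1).congr_deriv ?_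
    rw [hx.equation s hs.1.le]
    ring
  · refine ContinuousOn.intervalIntegrable ?_
    rw [Set.uIcc_of_le ht]
    exact hexp.continuousOn.mul (hb.mono Set.Icc_subset_Ici_self)

/-- Exponentially weighted averages of a convergent function converge. -/
theorem tendsto_exp_mul_integral {g : ℝ → ℝ} {c L : ℝ} (hc : 0 < c)
    (hg : ContinuousOn g (Set.Ici 0)) (hL : Tendsto g atTop (𝓝 L)) :
    Tendsto (fun t ↦ ∫ s in (0 : ℝ)..t, Real.exp (-c * (t - s)) * g s) atTop (𝓝 (L / c)) := by
  obtain ⟨M, hM⟩ : ∃ M, ∀ s, 0 ≤ s → |g s| ≤ M := by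
    obtain ⟨T, hT⟩ := eventually_atTop.1 (hL.abs.eventually (gt_mem_nhds (lt_add_one |L|)))
    obtain ⟨M, hM⟩ := isCompact_Icc.exists_bound_of_continuousOn
      (hg.mono (Set.Icc_subset_Ici_self : Set.Icc 0 T ⊆ Set.Ici 0))
    refine ⟨max M (|L| + 1), fun s hs ↦ ?_⟩
    rcases le_total s T with h | h
    · exact (hM s ⟨hs, h⟩).trans (le_max_left _ _)
    · exact (hT s h).le.trans (le_max_right _ _)
  have hexp : IntegrableOn (fun u : ℝ ↦ Real.exp (-c * u)) (Set.Ioi 0) :=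
    integrableOn_exp_mul_Ioi (by linarith) 0
  have hlim : ∫ u in Set.Ioi (0 : ℝ), Real.exp (-c * u) * L = L / c := by
    rw [integral_mul_const, integral_exp_mul_Ioi (by linarith)]
    simp
    field_simp
  rw [← hlim]
  -- The substitution `u = t - s` moves the dependence on `t` into `g (t - u)` and an indicator;
  -- dominated convergence then applies with `g` bounded by `M`.
  have hdom : Tendsto (fun t ↦ ∫ u in Set.Ioi (0 : ℝ),
      (Set.Ioc 0 t).indicator (fun u ↦ Real.exp (-c * u) * g (t - u)) u) atTop
      (𝓝 (∫ u in Set.Ioi (0 : ℝ), Real.exp (-c * u) * L)) := by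
    refine tendsto_integral_filter_of_dominated_convergence (fun u ↦ Real.exp (-c * u) * M)
      ?_ ?_ (hexp.mul_const M) ?_
    · refine Eventually.of_forall fun t ↦ ?_
      refine ((aestronglyMeasurable_indicator_iff measurableSet_Ioc).2 ?_).restrict
      refine ContinuousOn.aestronglyMeasurable ?_ measurableSet_Ioc
      refine ContinuousOn.mul (by fun_prop) ?_
      refine hg.comp (by fun_prop) fun u hu ↦ ?_
      simpa using hu.2
    · refine Eventually.of_forall fun t ↦ Eventually.of_forall fun u ↦ ?_
      have hM0 : 0 ≤ M := (abs_nonneg _).trans (hM 0 le_rfl)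
      by_cases hu : u ∈ Set.Ioc 0 t
      · rw [Set.indicator_of_mem hu, norm_mul, Real.norm_eq_abs, Real.abs_exp]
        exact mul_le_mul_of_nonneg_left (hM _ (by linarith [hu.2])) (Real.exp_nonneg _)
      · rw [Set.indicator_of_notMem hu, norm_zero]
        positivity
    · filter_upwards [ae_restrict_mem measurableSet_Ioi] with u hu
      have h1 : Tendsto (fun t ↦ Real.exp (-c * u) * g (t - u)) atTop
          (𝓝 (Real.exp (-c * u) * L)) :=
        (hL.comp (tendsto_atTop_add_const_right atTop (-u) tendsto_id)).const_mul _
      refine h1.congr' ?_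
      filter_upwards [eventually_ge_atTop u] with t ht
      have hut : u ∈ Set.Ioc 0 t := ⟨hu, ht⟩
      rw [Set.indicator_of_mem hut]
  refine hdom.congr' ?_
  filter_upwards [eventually_ge_atTop 0] with t ht
  rw [setIntegral_indicator measurableSet_Ioc, Set.inter_eq_self_of_subset_right
    Set.Ioc_subset_Ioi_self, ← intervalIntegral.integral_of_le ht]
  have h1 := intervalIntegral.integral_comp_sub_left (a := 0) (b := t)
    (fun s ↦ Real.exp (-c * (t - s)) * g s) t
  simpa using h1

/-- One term of the exponential series suffices: `(c (t + 1))³ / 3! ≤ e^(c (t + 1))`. -/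
theorem exists_cube_le_exp {c : ℝ} (hc : 0 < c) :
    ∃ C : ℝ, 0 ≤ C ∧ ∀ t : ℝ, 0 ≤ t → (t + 1) ^ 3 ≤ C * Real.exp (c * t) := by
  refine ⟨6 / c ^ 3 * Real.exp c, by positivity, fun t ht ↦ ?_⟩
  have h := Real.pow_div_factorial_le_exp (c * (t + 1)) (by positivity) 3
  have h2 : Real.exp (c * (t + 1)) = Real.exp c * Real.exp (c * t) := by
    rw [← Real.exp_add]
    ring_nf
  rw [h2, div_le_iff₀ (by positivity)] at h
  norm_num [Nat.factorial] at h
  have h3 : 6 / c ^ 3 * Real.exp c * Real.exp (c * t)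
      = (Real.exp c * Real.exp (c * t) * 6) / c ^ 3 := by ring
  rw [h3, le_div_iff₀ (by positivity)]
  nlinarith

/-- Half of the exponential rate absorbs the cubic growth; the other half gives integrability and
decay. -/
theorem integrableOn_exp_mul_of_cube_growth {θ A : ℝ} {b : ℝ → ℝ} (hθ : 0 < θ)
    (hb : ContinuousOn b (Set.Ici 0)) (hA : 0 ≤ A)
    (hg : ∀ t, 0 ≤ t → |b t| ≤ A * (t + 1) ^ 3) :
    IntegrableOn (fun s ↦ Real.exp (-θ * s) * b s) (Set.Ioi 0) ∧
      Tendsto (fun s ↦ Real.exp (-θ * s) * b s) atTop (𝓝 0) := by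
  obtain ⟨C, hC, hCt⟩ := exists_cube_le_exp (half_pos hθ)
  have hbd : ∀ s, 0 ≤ s → ‖Real.exp (-θ * s) * b s‖ ≤ A * C * Real.exp (-(θ / 2) * s) := by
    intro s hs
    rw [norm_mul, Real.norm_eq_abs, Real.norm_eq_abs, Real.abs_exp]
    have h1 : |b s| ≤ A * (C * Real.exp (θ / 2 * s)) :=
      (hg s hs).trans (mul_le_mul_of_nonneg_left (hCt s hs) hA)
    refine (mul_le_mul_of_nonneg_left h1 (Real.exp_nonneg _)).trans_eq ?_
    have h2 : Real.exp (-(θ / 2) * s) = Real.exp (-θ * s) * Real.exp (θ / 2 * s) := by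
      rw [← Real.exp_add]
      ring_nf
    rw [h2]
    ring
  constructor
  · refine Integrable.mono' ((integrableOn_exp_mul_Ioi (a := -(θ / 2)) (by linarith) 0).const_mul
      (A * C)) ?_ ?_
    · refine ContinuousOn.aestronglyMeasurable ?_ measurableSet_Ioi
      exact ContinuousOn.mul (by fun_prop) (hb.mono Set.Ioi_subset_Ici_self)
    · filter_upwards [ae_restrict_mem measurableSet_Ioi] with s hs
      exact hbd s (le_of_lt hs)
  · refine squeeze_zero_norm' (a := fun s ↦ A * C * Real.exp (-(θ / 2) * s)) ?_ ?_
    · filter_upwards [eventually_ge_atTop 0] with s hs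
      exact hbd s hs
    · have h1 : Tendsto (fun s : ℝ ↦ Real.exp (-(θ / 2) * s)) atTop (𝓝 0) := by
        refine Real.tendsto_exp_atBot.comp ?_
        exact tendsto_id.const_mul_atTop_of_neg (by linarith)
      simpa using h1.const_mul (A * C)

/-- The rescaled path `e^(-θt) x_t` converges to `θ ∫₀^∞ e^(-θs) b_s ds`. -/
theorem IsOUPath.tendsto_exp_mul {θ : ℝ} {b x : ℝ → ℝ} (hx : IsOUPath θ b x)
    (hb : ContinuousOn b (Set.Ici 0))
    (hint : IntegrableOn (fun s ↦ Real.exp (-θ * s) * b s) (Set.Ioi 0))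
    (hlim : Tendsto (fun s ↦ Real.exp (-θ * s) * b s) atTop (𝓝 0)) :
    Tendsto (fun t ↦ Real.exp (-θ * t) * x t) atTop
      (𝓝 (θ * ∫ s in Set.Ioi (0 : ℝ), Real.exp (-θ * s) * b s)) := by
  have h1 := ((intervalIntegral_tendsto_integral_Ioi 0 hint tendsto_id).const_mul θ).add hlim
  rw [add_zero] at h1
  refine h1.congr' ?_
  filter_upwards [eventually_ge_atTop 0] with t ht
  simp only [id]
  rw [← hx.exp_mul_integral hb ht, hx.equation t ht]
  ring

/-- Multiply numerator and denominator by `e^(-2θt)`: the numerator tends to `L²`, and the integral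
becomes an exponentially weighted average, of rate `2θ`, of a function tending to `L²`. -/
theorem tendsto_ratio_of_tendsto_exp_mul {θ L : ℝ} {x : ℝ → ℝ} (hθ : 0 < θ)
    (hx : ContinuousOn x (Set.Ici 0))
    (hL : L ≠ 0) (hlim : Tendsto (fun t ↦ Real.exp (-θ * t) * x t) atTop (𝓝 L)) :
    Tendsto (fun t ↦ x t ^ 2 / (2 * ∫ s in (0 : ℝ)..t, x s ^ 2)) atTop (𝓝 θ) := by
  have h1 := hlim.pow 2
  have h2 := tendsto_exp_mul_integral (c := 2 * θ) (g := fun t ↦ (Real.exp (-θ * t) * x t) ^ 2)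
    (by linarith) (ContinuousOn.pow (ContinuousOn.mul (by fun_prop) hx) 2) h1
  have h3 := h1.div (h2.const_mul 2) (by positivity)
  have h4 : L ^ 2 / (2 * (L ^ 2 / (2 * θ))) = θ := by field_simp
  rw [h4] at h3
  refine h3.congr fun t ↦ ?_
  have h5 : ∫ s in (0 : ℝ)..t, Real.exp (-(2 * θ) * (t - s)) * (Real.exp (-θ * s) * x s) ^ 2
      = Real.exp (-θ * t) ^ 2 * ∫ s in (0 : ℝ)..t, x s ^ 2 := by
    rw [← intervalIntegral.integral_const_mul]
    refine intervalIntegral.integral_congr fun s _ ↦ ?_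
    rw [mul_pow, ← mul_assoc, ← Real.exp_nat_mul, ← Real.exp_nat_mul, ← Real.exp_add]
    congr 2
    push_cast
    ring
  simp only [Pi.div_apply]
  rw [h5, mul_pow, mul_left_comm 2, mul_div_mul_left _ _ (by positivity)]

/-- The deterministic core. `hne` involves only countably many times, so it can hold almost surely
for all of them at once; it makes the denominator positive, while `hξ` makes the limit of `e^(-θt)
x_t` nonzero. -/
theorem IsOUPath.leastSquaresEstimator_spec {θ γ A : ℝ} {b x : ℝ → ℝ} (hθ : 0 < θ)
    (hγ : 1 / 2 < γ) (hγ1 : γ < 1) (hA : 0 ≤ A) (hx : IsOUPath θ b x)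
    (hb : ContinuousOn b (Set.Ici 0))
    (hloc : ∀ j : ℕ, ∀ s ∈ Set.Icc (j : ℝ) (j + 1), ∀ t ∈ Set.Icc (j : ℝ) (j + 1),
      |b t - b s| ≤ A * (j + 1) ^ 2 * |t - s| ^ γ)
    (hne : ∀ n : ℕ, b (1 / (n + 1)) ≠ 0)
    (hξ : ∫ s in Set.Ioi (0 : ℝ), Real.exp (-θ * s) * b s ≠ 0) :
    (∀ t : ℝ, 0 < t →
      (∃ I : ℝ, HasYoungIntegral x x 0 t I) ∧
      IntervalIntegrable (fun s ↦ x s ^ 2) volume 0 t ∧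
      0 < ∫ s in (0 : ℝ)..t, x s ^ 2 ∧
      leastSquaresEstimator x t = x t ^ 2 / (2 * ∫ s in (0 : ℝ)..t, x s ^ 2)) ∧
    Tendsto (fun t : ℝ ↦ leastSquaresEstimator x t) atTop (𝓝 θ) := by
  have hxc := hx.continuousOn hb
  have hyoung : ∀ t : ℝ, 0 < t → HasYoungIntegral x x 0 t (x t ^ 2 / 2) := by
    intro t ht
    obtain ⟨n, hn⟩ := exists_nat_ge t
    obtain ⟨D, hD, hbD⟩ := exists_holder_Icc_of_local (by linarith)
      (fun j : ℕ ↦ by positivity) hloc n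
    obtain ⟨K, hK, hxK⟩ := hx.exists_holder hγ1 hb hD hbD
    have := hasYoungIntegral_self hγ hγ1 hK ht.le
      fun s u hs hsu hu ↦ hxK s u hs hsu (hu.trans hn)
    simpa [hx.start_zero] using this
  have heq : ∀ t : ℝ, 0 < t →
      leastSquaresEstimator x t = x t ^ 2 / (2 * ∫ s in (0 : ℝ)..t, x s ^ 2) := by
    intro t ht
    rw [leastSquaresEstimator, youngIntegral_eq (hyoung t ht), div_div]
  have hsq : ContinuousOn (fun s ↦ x s ^ 2) (Set.Ici 0) := hxc.pow 2
  refine ⟨fun t ht ↦ ⟨⟨_, hyoung t ht⟩, ?_, ?_, heq t ht⟩, ?_⟩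
  · refine ContinuousOn.intervalIntegrable ?_
    rw [Set.uIcc_of_le ht.le]
    exact hsq.mono Set.Icc_subset_Ici_self
  -- If the integral of `x²` were not positive, `x` would vanish on `[0, t]`, and the equation at `1
  -- / (n + 1) < t` would give `b = 0` there.
  · obtain ⟨n, hn⟩ := exists_nat_one_div_lt ht
    have hn0 : (0 : ℝ) < 1 / (n + 1) := by positivity
    by_contra hcon
    have hzero : ∀ s ∈ Set.Icc 0 t, x s = 0 := by
      by_contra! hs
      obtain ⟨s, hs, hs0⟩ := hs
      exact hcon (intervalIntegral.integral_pos ht (hsq.mono Set.Icc_subset_Ici_self)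
        (fun u _ ↦ sq_nonneg _) ⟨s, hs, by positivity⟩)
    have h1 := hx.equation (1 / (n + 1)) hn0.le
    have h2 : ∫ s in (0 : ℝ)..(1 / (n + 1)), x s = 0 := by
      rw [intervalIntegral.integral_congr (g := fun _ ↦ (0 : ℝ))]
      · simp
      · intro s hs
        rw [Set.uIcc_of_le hn0.le] at hs
        exact hzero s ⟨hs.1, hs.2.trans hn.le⟩
    rw [h2, hzero _ ⟨hn0.le, hn.le⟩] at h1
    exact hne n (by linarith)
  · have hb0 : b 0 = 0 := by
      have := hx.equation 0 le_rfl
      rw [hx.start_zero] at this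
      simpa using this.symm
    obtain ⟨hint, hlim⟩ := integrableOn_exp_mul_of_cube_growth hθ hb hA
      fun t ht ↦ abs_le_of_local_holder (by linarith) hA hb0 hloc ht
    refine (tendsto_ratio_of_tendsto_exp_mul hθ hxc (mul_ne_zero hθ.ne' hξ)
      (hx.tendsto_exp_mul hb hint hlim)).congr' ?_
    filter_upwards [eventually_gt_atTop 0] with t ht
    exact (heq t ht).symm

/-! ### Moments of the increments of fractional Brownian motion -/

section Moments

variable {Ω : Type*} [MeasurableSpace Ω] {P : Measure Ω} {H : ℝ} {B : ℝ → Ω → ℝ}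

theorem IsFractionalBrownianMotion.hasGaussianLaw (hB : IsFractionalBrownianMotion H B P)
    {t : ℝ} (ht : 0 ≤ t) : HasGaussianLaw (B t) P := by
  lift t to ℝ≥0 using ht
  exact hB.gaussian.hasGaussianLaw_eval t

theorem IsFractionalBrownianMotion.hasGaussianLaw_sub (hB : IsFractionalBrownianMotion H B P)
    {s t : ℝ} (hs : 0 ≤ s) (ht : 0 ≤ t) : HasGaussianLaw (fun ω ↦ B t ω - B s ω) P := by
  lift t to ℝ≥0 using ht
  lift s to ℝ≥0 using hs
  exact hB.gaussian.hasGaussianLaw_fun_sub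

theorem IsFractionalBrownianMotion.integrable_mul (hB : IsFractionalBrownianMotion H B P)
    {s t : ℝ} (hs : 0 ≤ s) (ht : 0 ≤ t) : Integrable (fun ω ↦ B t ω * B s ω) P :=
  (hB.hasGaussianLaw ht).memLp_two.integrable_mul (hB.hasGaussianLaw hs).memLp_two

theorem IsFractionalBrownianMotion.integral_sq_sub (hB : IsFractionalBrownianMotion H B P)
    (hH : 0 < H) {s t : ℝ} (hs : 0 ≤ s) (ht : 0 ≤ t) :
    ∫ ω, (B t ω - B s ω) ^ 2 ∂P = |t - s| ^ (2 * H) := by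
  have h1 : ∀ ω, (B t ω - B s ω) ^ 2 = B t ω * B t ω - 2 * (B t ω * B s ω) + B s ω * B s ω :=
    fun ω ↦ by ring
  simp_rw [h1]
  have h2 : Integrable (fun ω ↦ B t ω * B t ω - 2 * (B t ω * B s ω)) P :=
    (hB.integrable_mul ht ht).sub ((hB.integrable_mul hs ht).const_mul 2)
  rw [integral_add h2 (hB.integrable_mul hs hs), integral_sub (hB.integrable_mul ht ht)
    ((hB.integrable_mul hs ht).const_mul 2), integral_const_mul, hB.covariance t t ht ht,
    hB.covariance s s hs hs, hB.covariance s t hs ht]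
  simp only [sub_self, abs_zero]
  rw [Real.zero_rpow (by linarith)]
  ring

/-- Writing the law as a scaled standard normal covers the degenerate case `s = t` and makes all
moments scale explicitly, with constants independent of `s` and `t`. -/
theorem IsFractionalBrownianMotion.map_sub (hB : IsFractionalBrownianMotion H B P)
    (hH : 0 < H) {s t : ℝ} (hs : 0 ≤ s) (ht : 0 ≤ t) :
    P.map (fun ω ↦ B t ω - B s ω) = (gaussianReal 0 1).map (fun x ↦ |t - s| ^ H * x) := by
  have hlaw := hB.hasGaussianLaw_sub hs ht
  have hmean : ∫ ω, (B t ω - B s ω) ∂P = 0 := by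
    rw [integral_sub (hB.hasGaussianLaw ht).integrable (hB.hasGaussianLaw hs).integrable,
      hB.centered t ht, hB.centered s hs, sub_zero]
  rw [hlaw.map_eq_gaussianReal, hmean, variance_of_integral_eq_zero hlaw.aemeasurable hmean,
    hB.integral_sq_sub hH hs ht, gaussianReal_map_const_mul]
  congr 1
  · simp
  · apply NNReal.coe_injective
    rw [Real.coe_toNNReal _ (by positivity)]
    simp only [mul_one, NNReal.coe_mk]
    rw [← Real.rpow_natCast, ← Real.rpow_mul (abs_nonneg _)]
    congr 1
    push_cast
    ring

theorem IsFractionalBrownianMotion.exists_lintegral_pow_sub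
    (hB : IsFractionalBrownianMotion H B P) (hH : 0 < H) (p : ℕ) :
    ∃ C : ENNReal, C ≠ ⊤ ∧ ∀ s t : ℝ, 0 ≤ s → 0 ≤ t →
      ∫⁻ ω, ‖B t ω - B s ω‖ₑ ^ p ∂P = ENNReal.ofReal (|t - s| ^ (H * p)) * C := by
  refine ⟨∫⁻ x, ‖x‖ₑ ^ p ∂(gaussianReal 0 1), ?_, fun s t hs ht ↦ ?_⟩
  · have h := (memLp_id_gaussianReal (μ := 0) (v := 1) p).integrable_norm_pow'
    have h2 := h.2
    simp only [HasFiniteIntegral, enorm_pow, enorm_norm, id] at h2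
    exact h2.ne
  · have hlaw := hB.hasGaussianLaw_sub hs ht
    rw [← lintegral_map' (f := fun x : ℝ ↦ ‖x‖ₑ ^ p) (by fun_prop) hlaw.aemeasurable,
      hB.map_sub hH hs ht, lintegral_map (by fun_prop) (by fun_prop),
      ← lintegral_const_mul _ (by fun_prop)]
    refine lintegral_congr fun x ↦ ?_
    rw [enorm_mul, mul_pow]
    congr 1
    rw [Real.enorm_of_nonneg (by positivity), ← ENNReal.ofReal_pow (by positivity),
      ← Real.rpow_natCast, ← Real.rpow_mul (abs_nonneg _)]

end Moments

/-! ### Almost sure Hölder continuity with controlled constants -/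

section Paths

variable {Ω : Type*} [MeasurableSpace Ω] {P : Measure Ω} {H : ℝ} {B : ℝ → Ω → ℝ}

/-- Almost surely, the dyadic increments of fractional Brownian motion at scale `2⁻ⁿ` are of
order `2^(-γ n)` for `γ < H`, with a constant that grows quadratically in time. -/
theorem IsFractionalBrownianMotion.ae_exists_dyadic_bound
    (hB : IsFractionalBrownianMotion H B P) (hH : 0 < H) {γ : ℝ} (hγH : γ < H) :
    ∀ᵐ ω ∂P, ∃ A : ℝ, 0 ≤ A ∧ ∀ j n k : ℕ, k < 2 ^ n →
      |B (j + (k + 1) / 2 ^ n) ω - B (j + k / 2 ^ n) ω|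
        ≤ A * (j + 1) ^ 2 * ((2 : ℝ) ^ (-γ)) ^ n := by
  -- Level `n` has `2^n` increments with `p`-th moment of order `2^(-nHp)`. After weighting by
  -- `2^(nγp)` their sum has order `ρ^n`, and `ρ < 1` is the condition `(H - γ) p > 1`.
  obtain ⟨p, hp⟩ := exists_nat_gt (1 / (H - γ))
  have hp1 : 1 < (H - γ) * p := by
    rw [div_lt_iff₀ (by linarith)] at hp
    linarith
  have hp0 : p ≠ 0 := by
    rintro rfl
    norm_num at hp1
  obtain ⟨C, hC, hmom⟩ := hB.exists_lintegral_pow_sub hH p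
  let w : ℕ → ENNReal := fun j ↦ ENNReal.ofReal (((j : ℝ) + 1) ^ 2)⁻¹
  let c : ℕ → ENNReal := fun n ↦ ENNReal.ofReal (((2 : ℝ) ^ (γ * p)) ^ n)
  let Δ : ℕ → ℕ → ℕ → Ω → ℝ := fun j n k ω ↦
    B (j + (k + 1) / 2 ^ n) ω - B (j + k / 2 ^ n) ω
  -- One variable of finite mean controls all increments at once; the summable weights `(j + 1)⁻²`
  -- over the unit intervals are the source of the quadratic growth of the constants.
  let F : Ω → ENNReal := fun ω ↦ ∑' j, ∑' n, ∑ k ∈ Finset.range (2 ^ n),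
    w j * c n * ‖Δ j n k ω‖ₑ ^ p
  have hΔ : ∀ j n k, AEMeasurable (fun ω ↦ w j * c n * ‖Δ j n k ω‖ₑ ^ p) P := fun j n k ↦
    (((hB.hasGaussianLaw_sub (by positivity) (by positivity)).aemeasurable.enorm).pow_const
      p).const_mul _
  have hF : AEMeasurable F P :=
    AEMeasurable.tsum fun j ↦ AEMeasurable.tsum fun n ↦
      Finset.aemeasurable_fun_sum _ fun k _ ↦ hΔ j n k
  set ρ : ℝ := (2 : ℝ) ^ (1 - (H - γ) * p) with hρ
  have hρ0 : 0 < ρ := by positivity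
  have hρ1 : ρ < 1 := Real.rpow_lt_one_of_one_lt_of_neg (by norm_num) (by linarith)
  have hterm : ∀ j n, ∫⁻ ω, ∑ k ∈ Finset.range (2 ^ n), w j * c n * ‖Δ j n k ω‖ₑ ^ p ∂P
      = w j * (C * ENNReal.ofReal (ρ ^ n)) := by
    intro j n
    rw [lintegral_finsetSum' _ fun k _ ↦ hΔ j n k]
    have h1 : ∀ k ∈ Finset.range (2 ^ n), ∫⁻ ω, w j * c n * ‖Δ j n k ω‖ₑ ^ p ∂P
        = w j * c n * (ENNReal.ofReal (((2 : ℝ) ^ n)⁻¹ ^ (H * p)) * C) := by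
      intro k _
      rw [lintegral_const_mul'' _ ((hB.hasGaussianLaw_sub (by positivity)
        (by positivity)).aemeasurable.enorm.pow_const p), hmom _ _ (by positivity) (by positivity)]
      congr 4
      have h2 : (j : ℝ) + (k + 1) / 2 ^ n - (j + k / 2 ^ n) = ((2 : ℝ) ^ n)⁻¹ := by
        field_simp
        ring
      rw [h2, abs_of_pos (by positivity)]
    rw [Finset.sum_congr rfl h1, Finset.sum_const, Finset.card_range, nsmul_eq_mul]
    have h3 : ρ ^ n = 2 ^ n * ((2 : ℝ) ^ (γ * p)) ^ n * ((2 : ℝ) ^ n)⁻¹ ^ (H * p) := by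
      have h4 : ((2 : ℝ) ^ n)⁻¹ ^ (H * p) = ((2 : ℝ) ^ (-(H * p))) ^ n := by
        rw [← Real.rpow_natCast 2 n, ← Real.rpow_neg (by norm_num), ← Real.rpow_mul (by norm_num),
          ← Real.rpow_natCast, ← Real.rpow_mul (by norm_num)]
        congr 1
        ring
      rw [h4, ← mul_pow, ← mul_pow, hρ]
      congr 1
      have h5 : (2 : ℝ) * 2 ^ (γ * p) = 2 ^ (1 + γ * p) := by
        rw [Real.rpow_add (by norm_num), Real.rpow_one]
      rw [h5, ← Real.rpow_add (by norm_num)]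
      congr 1
      ring
    rw [h3, ENNReal.ofReal_mul (by positivity), ENNReal.ofReal_mul (by positivity)]
    have h6 : ((2 ^ n : ℕ) : ENNReal) = ENNReal.ofReal (2 ^ n) := by
      rw [← ENNReal.ofReal_natCast]
      push_cast
      rfl
    rw [h6]
    ring
  have hfin : ∫⁻ ω, F ω ∂P ≠ ⊤ := by
    have h1 : ∫⁻ ω, F ω ∂P = ∑' j, w j * (C * ∑' n : ℕ, ENNReal.ofReal (ρ ^ n)) := by
      rw [lintegral_tsum fun j ↦ AEMeasurable.tsum fun n ↦
        Finset.aemeasurable_fun_sum _ fun k _ ↦ hΔ j n k]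
      refine tsum_congr fun j ↦ ?_
      rw [lintegral_tsum fun n ↦ Finset.aemeasurable_fun_sum _ fun k _ ↦ hΔ j n k]
      simp_rw [hterm, ENNReal.tsum_mul_left]
    rw [h1, ENNReal.tsum_mul_right]
    have h2 : Summable fun j : ℕ ↦ (((j : ℝ) + 1) ^ 2)⁻¹ := by
      have := (summable_nat_add_iff 1).2 (Real.summable_nat_pow_inv.2 (le_refl 2))
      simpa using this
    have h3 : Summable fun n : ℕ ↦ ρ ^ n := summable_geometric_of_lt_one hρ0.le hρ1
    exact ENNReal.mul_ne_top h2.tsum_ofReal_ne_top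
      (ENNReal.mul_ne_top hC h3.tsum_ofReal_ne_top)
  filter_upwards [ae_lt_top' hF hfin] with ω hω
  refine ⟨1 + (F ω).toReal, by positivity, fun j n k hk ↦ ?_⟩
  have hle : w j * c n * ‖Δ j n k ω‖ₑ ^ p ≤ F ω := by
    refine le_trans ?_ (ENNReal.le_tsum j)
    refine le_trans ?_ (ENNReal.le_tsum n)
    exact Finset.single_le_sum (f := fun k ↦ w j * c n * ‖Δ j n k ω‖ₑ ^ p)
      (fun _ _ ↦ zero_le) (Finset.mem_range.2 hk)
  have hreal : (((j : ℝ) + 1) ^ 2)⁻¹ * ((2 : ℝ) ^ (γ * p)) ^ n * |Δ j n k ω| ^ p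
      ≤ (F ω).toReal := by
    have h1 := ENNReal.toReal_mono hω.ne hle
    rwa [ENNReal.toReal_mul, ENNReal.toReal_mul, ENNReal.toReal_pow,
      ENNReal.toReal_ofReal (by positivity), ENNReal.toReal_ofReal (by positivity),
      toReal_enorm, Real.norm_eq_abs] at h1
  set y : ℝ := ((2 : ℝ) ^ γ) ^ n * |Δ j n k ω| with hy
  have hyp : y ^ p ≤ (F ω).toReal * (j + 1) ^ 2 := by
    have h1 : y ^ p = ((2 : ℝ) ^ (γ * p)) ^ n * |Δ j n k ω| ^ p := by
      rw [hy, mul_pow, ← pow_mul, mul_comm n p, pow_mul, Real.rpow_mul (by norm_num),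
        Real.rpow_natCast]
    rw [mul_assoc, ← h1, inv_mul_le_iff₀ (by positivity)] at hreal
    linarith
  -- No `p`-th root is taken: a `y` above the bound exceeds `1`, so `y ≤ y ^ p`, contradicting
  -- `hyp`. This is why `1` is added to `F`.
  have hyA : y ≤ (1 + (F ω).toReal) * (j + 1) ^ 2 := by
    by_contra! hcon
    have hj : (1 : ℝ) ≤ ((j : ℝ) + 1) ^ 2 := by
      have : (0 : ℝ) ≤ j := by positivity
      nlinarith
    have hF0 : 0 ≤ (F ω).toReal := ENNReal.toReal_nonneg
    have h2 : 1 ≤ y := by nlinarith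
    have h3 := le_self_pow₀ h2 hp0
    nlinarith
  have h4 : |Δ j n k ω| = y * ((2 : ℝ) ^ (-γ)) ^ n := by
    rw [hy, mul_right_comm, ← mul_pow, ← Real.rpow_add (by norm_num)]
    simp
  change |Δ j n k ω| ≤ _
  rw [h4]
  gcongr

/-- Almost surely, fractional Brownian motion is Hölder continuous of every order `γ < H` on
unit intervals, with a constant that grows quadratically in time. -/
theorem IsFractionalBrownianMotion.ae_exists_local_holder
    (hB : IsFractionalBrownianMotion H B P) {γ : ℝ} (hγ : 0 < γ) (hγH : γ < H) :
    ∀ᵐ ω ∂P, ∃ A : ℝ, 0 ≤ A ∧ ∀ j : ℕ, ∀ s ∈ Set.Icc (j : ℝ) (j + 1),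
      ∀ t ∈ Set.Icc (j : ℝ) (j + 1), |B t ω - B s ω| ≤ A * (j + 1) ^ 2 * |t - s| ^ γ := by
  obtain ⟨C, hC, hchain⟩ := abs_sub_le_of_dyadic hγ
  filter_upwards [hB.ae_exists_dyadic_bound (hγ.trans hγH) hγH, hB.continuous_paths]
    with ω ⟨A, hA, hd⟩ hc
  refine ⟨C * A, by positivity, fun j s hs t ht ↦ ?_⟩
  rw [mul_assoc C]
  refine hchain (fun t ↦ B t ω) j (A * (j + 1) ^ 2) (by positivity) (hc.mono fun u hu ↦ ?_)
    (fun n k hk ↦ hd j n k hk) s hs t ht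
  have : (0 : ℝ) ≤ j := by positivity
  exact this.trans hu.1

end Paths

/-! ### Small ball estimates and absence of an atom at zero -/

section SmallBall

variable {Ω : Type*} [MeasurableSpace Ω] {P : Measure Ω}

/-- Gaussian small ball estimate. -/
theorem measure_abs_lt_le_of_hasGaussianLaw {Y : Ω → ℝ} (hY : HasGaussianLaw Y P)
    (hmean : ∫ ω, Y ω ∂P = 0) {v : ℝ} (hv : 0 < v) (hvar : v ≤ ∫ ω, Y ω ^ 2 ∂P)
    (ε : ℝ) :
    P {ω | |Y ω| < ε} ≤ ENNReal.ofReal ((√(2 * Real.pi * v))⁻¹ * 2 * ε) := by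
  have hlaw := hY.map_eq_gaussianReal
  rw [hmean, variance_of_integral_eq_zero hY.aemeasurable hmean] at hlaw
  have hset : {ω | |Y ω| < ε} = Y ⁻¹' (Set.Ioo (-ε) ε) := by
    ext ω
    simp [abs_lt]
  have hv' : 0 < ∫ ω, Y ω ^ 2 ∂P := hv.trans_le hvar
  have hne : (∫ ω, Y ω ^ 2 ∂P).toNNReal ≠ 0 := by
    simpa using hv'
  rw [hset, ← Measure.map_apply_of_aemeasurable hY.aemeasurable measurableSet_Ioo]
  rw [hlaw]
  rw [gaussianReal_apply _ hne]
  -- The density is at most its peak value, which decreases in the variance and so may be evaluated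
  -- at the lower bound `v`.
  calc ∫⁻ x in Set.Ioo (-ε) ε, gaussianPDF 0 (∫ ω, Y ω ^ 2 ∂P).toNNReal x
      ≤ ∫⁻ _ in Set.Ioo (-ε) ε, ENNReal.ofReal (√(2 * Real.pi * v))⁻¹ := by
        refine lintegral_mono fun x ↦ ENNReal.ofReal_le_ofReal ?_
        rw [gaussianPDFReal_def]
        simp only
        rw [Real.coe_toNNReal _ hv'.le]
        have h1 : Real.exp (-(x - 0) ^ 2 / (2 * ∫ ω, Y ω ^ 2 ∂P)) ≤ 1 := by
          rw [Real.exp_le_one_iff]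
          exact div_nonpos_of_nonpos_of_nonneg (by nlinarith [sq_nonneg (x - 0)]) (by positivity)
        refine (mul_le_of_le_one_right (by positivity) h1).trans ?_
        have hpi := Real.pi_pos
        gcongr
    _ = ENNReal.ofReal ((√(2 * Real.pi * v))⁻¹ * 2 * ε) := by
        rw [setLIntegral_const, Real.volume_Ioo, ← ENNReal.ofReal_mul (by positivity)]
        congr 1
        ring

/-- Small ball estimates pass to almost sure limits. -/
theorem measure_abs_lt_le_of_tendsto {C : ℝ} {Y : ℕ → Ω → ℝ} {Z : Ω → ℝ}
    (hY : ∀ n, ∀ ε : ℝ, 0 < ε → P {ω | |Y n ω| < ε} ≤ ENNReal.ofReal (C * ε))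
    (hlim : ∀ᵐ ω ∂P, Tendsto (fun n ↦ Y n ω) atTop (𝓝 (Z ω))) {ε : ℝ} (hε : 0 < ε) :
    P {ω | |Z ω| < ε} ≤ ENNReal.ofReal (C * ε) := by
  -- Almost surely `|Z| < ε` forces `|Y n| < ε` from some index on. Continuity from below along
  -- increasing sets needs no measurability of `Y n` or `Z`.
  let S : ℕ → Set Ω := fun N ↦ {ω | ∀ n, N ≤ n → |Y n ω| < ε}
  have hS : Monotone S := fun M N hMN ω hω n hn ↦ hω n (hMN.trans hn)
  have h1 : P {ω | |Z ω| < ε} ≤ P (⋃ N, S N) := by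
    refine measure_mono_ae ?_
    filter_upwards [hlim] with ω hω (hZ : |Z ω| < ε)
    exact Set.mem_iUnion.2 (eventually_atTop.1 (hω.abs.eventually (gt_mem_nhds hZ)))
  refine h1.trans ?_
  rw [hS.measure_iUnion]
  exact iSup_le fun N ↦ (measure_mono fun ω (hω : ω ∈ S N) ↦ hω N le_rfl).trans (hY N ε hε)

theorem ae_ne_zero_of_measure_abs_lt_le {C : ℝ} {Z : Ω → ℝ}
    (hZ : ∀ ε : ℝ, 0 < ε → P {ω | |Z ω| < ε} ≤ ENNReal.ofReal (C * ε)) :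
    ∀ᵐ ω ∂P, Z ω ≠ 0 := by
  rw [ae_iff]
  simp only [not_not, ne_eq]
  have h1 : Tendsto (fun ε : ℝ ↦ ENNReal.ofReal (C * ε)) (𝓝[>] 0) (𝓝 0) := by
    have : Tendsto (fun ε : ℝ ↦ ENNReal.ofReal (C * ε)) (𝓝 0) (𝓝 (ENNReal.ofReal (C * 0))) :=
      (ENNReal.continuous_ofReal.comp (continuous_const.mul continuous_id)).tendsto 0
    rw [mul_zero, ENNReal.ofReal_zero] at this
    exact this.mono_left nhdsWithin_le_nhds
  refine le_antisymm (ge_of_tendsto h1 ?_) zero_le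
  filter_upwards [self_mem_nhdsWithin] with ε (hε : 0 < ε)
  refine (measure_mono fun ω (hω : Z ω = 0) ↦ ?_).trans (hZ ε hε)
  simpa [hω] using hε

end SmallBall

/-! ### Riemann sums and nondegeneracy of the exponential functional -/

/-- Riemann sums over uniform partitions of `[0, n]` converge. -/
theorem tendsto_riemannSum {f : ℝ → ℝ} {n : ℕ} (hf : ContinuousOn f (Set.Icc 0 n)) :
    Tendsto (fun k : ℕ ↦ ∑ i ∈ Finset.range (n * (k + 1)), 1 / ((k : ℝ) + 1) * f (i / (k + 1)))
      atTop (𝓝 (∫ s in (0 : ℝ)..n, f s)) := by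
  rw [Metric.tendsto_atTop]
  intro ε hε
  -- Dividing by `n + 1` rather than by the length `n` includes `n = 0` and leaves the strict
  -- inequality `n / (n + 1) * ε < ε` at the end.
  have hε' : 0 < ε / (n + 1) := by positivity
  obtain ⟨δ, hδ, hδf⟩ := Metric.uniformContinuousOn_iff.1
    (isCompact_Icc.uniformContinuousOn_of_continuous hf) (ε / (n + 1)) hε'
  obtain ⟨N, hN⟩ := exists_nat_one_div_lt hδ
  refine ⟨N, fun k hk ↦ ?_⟩
  have hk0 : (0 : ℝ) < k + 1 := by positivity
  have hh : 1 / ((k : ℝ) + 1) < δ := by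
    refine lt_of_le_of_lt ?_ hN
    have : (N : ℝ) ≤ k := by exact_mod_cast hk
    gcongr
  let u : ℕ → ℝ := fun i ↦ i / (k + 1)
  have hu : ∀ i, u (i + 1) - u i = 1 / (k + 1) := fun i ↦ by
    simp only [u]
    push_cast
    ring
  have hu0 : ∀ i, 0 ≤ u i := fun i ↦ by positivity
  have hmem : ∀ i, i < n * (k + 1) → u (i + 1) ≤ n := fun i hi ↦ by
    simp only [u]
    rw [div_le_iff₀ hk0]
    exact_mod_cast hi
  have hsub : ∀ i, i < n * (k + 1) → Set.Icc (u i) (u (i + 1)) ⊆ Set.Icc 0 (n : ℝ) :=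
    fun i hi ↦ Set.Icc_subset_Icc (hu0 i) (hmem i hi)
  have hle : ∀ i, u i ≤ u (i + 1) := fun i ↦ by
    have := hu i
    have h2 : (0 : ℝ) < 1 / (k + 1) := by positivity
    linarith
  have hint : ∀ i < n * (k + 1), IntervalIntegrable f volume (u i) (u (i + 1)) := fun i hi ↦ by
    refine ContinuousOn.intervalIntegrable ?_
    rw [Set.uIcc_of_le (hle i)]
    exact hf.mono (hsub i hi)
  have hsum := intervalIntegral.sum_integral_adjacent_intervals hint
  have hu_zero : u 0 = 0 := by simp [u]
  have hu_end : u (n * (k + 1)) = n := by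
    simp only [u]
    push_cast
    field_simp
  rw [hu_zero, hu_end] at hsum
  rw [Real.dist_eq, ← hsum, ← Finset.sum_sub_distrib]
  refine (Finset.abs_sum_le_sum_abs _ _).trans_lt ?_
  have hterm : ∀ i ∈ Finset.range (n * (k + 1)),
      |1 / ((k : ℝ) + 1) * f (i / (k + 1)) - ∫ s in u i..u (i + 1), f s|
        ≤ ε / (n + 1) * (1 / (k + 1)) := by
    intro i hi
    rw [Finset.mem_range] at hi
    have h1 : 1 / ((k : ℝ) + 1) * f (i / (k + 1)) - ∫ s in u i..u (i + 1), f s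
        = ∫ s in u i..u (i + 1), (f (u i) - f s) := by
      rw [intervalIntegral.integral_sub intervalIntegrable_const (hint i hi),
        intervalIntegral.integral_const, hu, smul_eq_mul]
    have h2 : ‖∫ s in u i..u (i + 1), (f (u i) - f s)‖ ≤ ε / (n + 1) * |u (i + 1) - u i| := by
      refine intervalIntegral.norm_integral_le_of_norm_le_const fun s hs ↦ ?_
      rw [Set.uIoc_of_le (hle i)] at hs
      refine (hδf (u i) (hsub i hi ⟨le_rfl, hle i⟩) s (hsub i hi ⟨hs.1.le, hs.2⟩) ?_).le
      rw [Real.dist_eq, abs_sub_comm, abs_of_pos (by linarith [hs.1])]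
      linarith [hs.2, hu i]
    rw [hu, abs_of_pos (by positivity), Real.norm_eq_abs] at h2
    rw [h1]
    exact h2
  refine (Finset.sum_le_sum hterm).trans_lt ?_
  rw [Finset.sum_const, Finset.card_range, nsmul_eq_mul]
  push_cast
  have h3 : (n : ℝ) * (k + 1) * (ε / (n + 1) * (1 / (k + 1))) = n / (n + 1) * ε := by
    field_simp
  rw [h3]
  refine mul_lt_of_lt_one_left hε ?_
  rw [div_lt_one (by positivity)]
  linarith

section Nondegeneracy

variable {Ω : Type*} [MeasurableSpace Ω] {P : Measure Ω} {H : ℝ} {B : ℝ → Ω → ℝ}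

/-- Since `|t - s| ≤ max s t`, the subtracted power is at most the larger of the other two.
Nonnegative correlation rules out cancellation in sums with nonnegative weights. -/
theorem half_min_rpow_le_covariance {H s t : ℝ} (hH : 0 < H) (hs : 0 ≤ s) (ht : 0 ≤ t) :
    1 / 2 * (min s t) ^ (2 * H) ≤
      1 / 2 * (t ^ (2 * H) + s ^ (2 * H) - |t - s| ^ (2 * H)) := by
  rcases le_total s t with h | h
  · have : |t - s| ^ (2 * H) ≤ t ^ (2 * H) := by
      refine Real.rpow_le_rpow (abs_nonneg _) ?_ (by linarith)
      rw [abs_of_nonneg (by linarith)]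
      linarith
    rw [min_eq_left h]
    linarith
  · have : |t - s| ^ (2 * H) ≤ s ^ (2 * H) := by
      refine Real.rpow_le_rpow (abs_nonneg _) ?_ (by linarith)
      rw [abs_of_nonpos (by linarith)]
      linarith
    rw [min_eq_right h]
    linarith

theorem IsFractionalBrownianMotion.hasGaussianLaw_sum (hB : IsFractionalBrownianMotion H B P)
    (I : Finset ℕ) (w s : ℕ → ℝ) (hs : ∀ i, 0 ≤ s i) :
    HasGaussianLaw (fun ω ↦ ∑ i ∈ I, w i * B (s i) ω) P := by
  have h := ((hB.gaussian.comp_right fun i ↦ (s i).toNNReal).smul w).hasGaussianLaw_fun_sum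
    (I := I)
  simpa only [Function.comp_apply, Real.coe_toNNReal _ (hs _), smul_eq_mul] using h

/-- Positive combinations of fractional Brownian motion do not degenerate. -/
theorem IsFractionalBrownianMotion.half_sq_sum_le_integral_sq
    (hB : IsFractionalBrownianMotion H B P) (hH : 0 < H) {I J : Finset ℕ} (hJI : J ⊆ I)
    {w s : ℕ → ℝ} (hs : ∀ i, 0 ≤ s i) (hw : ∀ i, 0 ≤ w i) (hJ : ∀ i ∈ J, 1 ≤ s i) :
    1 / 2 * (∑ i ∈ J, w i) ^ 2 ≤ ∫ ω, (∑ i ∈ I, w i * B (s i) ω) ^ 2 ∂P := by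
  have hexp : ∫ ω, (∑ i ∈ I, w i * B (s i) ω) ^ 2 ∂P
      = ∑ i ∈ I, ∑ j ∈ I, w i * w j * ∫ ω, B (s i) ω * B (s j) ω ∂P := by
    have h1 : ∀ ω, (∑ i ∈ I, w i * B (s i) ω) ^ 2
        = ∑ i ∈ I, ∑ j ∈ I, w i * w j * (B (s i) ω * B (s j) ω) := fun ω ↦ by
      rw [sq, Finset.sum_mul_sum]
      refine Finset.sum_congr rfl fun i _ ↦ Finset.sum_congr rfl fun j _ ↦ ?_
      ring
    simp_rw [h1]
    rw [integral_finsetSum _ fun i _ ↦ integrable_finsetSum _ fun j _ ↦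
      (hB.integrable_mul (hs j) (hs i)).const_mul _]
    refine Finset.sum_congr rfl fun i _ ↦ ?_
    rw [integral_finsetSum _ fun j _ ↦ (hB.integrable_mul (hs j) (hs i)).const_mul _]
    exact Finset.sum_congr rfl fun j _ ↦ integral_const_mul _ _
  have hcov : ∀ i j, 1 / 2 * (min (s j) (s i)) ^ (2 * H) ≤ ∫ ω, B (s i) ω * B (s j) ω ∂P :=
    fun i j ↦ by
      rw [hB.covariance (s j) (s i) (hs j) (hs i)]
      exact half_min_rpow_le_covariance hH (hs j) (hs i)
  have hnonneg : ∀ i j, 0 ≤ w i * w j * ∫ ω, B (s i) ω * B (s j) ω ∂P := fun i j ↦ by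
    have h1 : 0 ≤ 1 / 2 * (min (s j) (s i)) ^ (2 * H) := by
      have := le_min (hs j) (hs i)
      positivity
    exact mul_nonneg (mul_nonneg (hw i) (hw j)) (h1.trans (hcov i j))
  rw [hexp, sq, Finset.sum_mul_sum, Finset.mul_sum]
  -- Pairs in `J × J` have covariance at least `1 / 2`, as both times are at least `1`; all
  -- remaining pairs contribute nonnegatively.
  calc ∑ i ∈ J, 1 / 2 * ∑ j ∈ J, w i * w j
      ≤ ∑ i ∈ J, ∑ j ∈ J, w i * w j * ∫ ω, B (s i) ω * B (s j) ω ∂P := by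
        refine Finset.sum_le_sum fun i hi ↦ ?_
        rw [Finset.mul_sum]
        refine Finset.sum_le_sum fun j hj ↦ ?_
        have h1 : (1 : ℝ) ≤ (min (s j) (s i)) ^ (2 * H) :=
          Real.one_le_rpow (le_min (hJ j hj) (hJ i hi)) (by linarith)
        rw [mul_comm]
        refine mul_le_mul_of_nonneg_left ?_ (mul_nonneg (hw i) (hw j))
        linarith [hcov i j]
    _ ≤ ∑ i ∈ J, ∑ j ∈ I, w i * w j * ∫ ω, B (s i) ω * B (s j) ω ∂P :=
        Finset.sum_le_sum fun i _ ↦ Finset.sum_le_sum_of_subset_of_nonneg hJI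
          fun j _ _ ↦ hnonneg i j
    _ ≤ ∑ i ∈ I, ∑ j ∈ I, w i * w j * ∫ ω, B (s i) ω * B (s j) ω ∂P :=
        Finset.sum_le_sum_of_subset_of_nonneg hJI fun i _ _ ↦
          Finset.sum_nonneg fun j _ ↦ hnonneg i j

theorem IsFractionalBrownianMotion.integral_sum_eq_zero
    (hB : IsFractionalBrownianMotion H B P) (I : Finset ℕ) (w s : ℕ → ℝ) (hs : ∀ i, 0 ≤ s i) :
    ∫ ω, ∑ i ∈ I, w i * B (s i) ω ∂P = 0 := by
  rw [integral_finsetSum _ fun i _ ↦ ((hB.hasGaussianLaw (hs i)).integrable.const_mul _)]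
  refine Finset.sum_eq_zero fun i _ ↦ ?_
  rw [integral_const_mul, hB.centered _ (hs i), mul_zero]

theorem IsFractionalBrownianMotion.ae_ne_zero (hB : IsFractionalBrownianMotion H B P)
    (hH : 0 < H) {t : ℝ} (ht : 0 < t) : ∀ᵐ ω ∂P, B t ω ≠ 0 := by
  refine ae_ne_zero_of_measure_abs_lt_le fun ε _ ↦
    measure_abs_lt_le_of_hasGaussianLaw (hB.hasGaussianLaw ht.le) (hB.centered t ht.le)
      (v := t ^ (2 * H)) (by positivity) (le_of_eq ?_) ε
  simp_rw [sq]
  rw [hB.covariance t t ht.le ht.le]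
  simp only [sub_self, abs_zero]
  rw [Real.zero_rpow (by linarith)]
  ring

/-- The bound must be uniform in `n` and `k`. The nodes in `[1, 2)`, present because `n ≥ 2`, carry
total weight at least `e^(-2θ)` for every mesh, so the variance is at least `e^(-4θ) / 2`. -/
theorem IsFractionalBrownianMotion.measure_abs_riemannSum_lt_le
    (hB : IsFractionalBrownianMotion H B P) (hH : 0 < H) {θ : ℝ} (hθ : 0 < θ) {n : ℕ}
    (hn : 2 ≤ n) (k : ℕ) (ε : ℝ) :
    P {ω | |∑ i ∈ Finset.range (n * (k + 1)),
        1 / ((k : ℝ) + 1) * (Real.exp (-θ * (i / (k + 1))) * B (i / (k + 1)) ω)| < ε}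
      ≤ ENNReal.ofReal
        ((√(2 * Real.pi * (1 / 2 * Real.exp (-θ * 2) ^ 2)))⁻¹ * 2 * ε) := by
  let s : ℕ → ℝ := fun i ↦ i / (k + 1)
  let w : ℕ → ℝ := fun i ↦ 1 / ((k : ℝ) + 1) * Real.exp (-θ * (i / (k + 1)))
  have hs : ∀ i, 0 ≤ s i := fun i ↦ by positivity
  have hw : ∀ i, 0 ≤ w i := fun i ↦ by positivity
  have hk0 : (0 : ℝ) < k + 1 := by positivity
  let J := Finset.Ico (k + 1) (2 * (k + 1))
  have hJI : J ⊆ Finset.range (n * (k + 1)) := fun i hi ↦ by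
    rw [Finset.mem_Ico] at hi
    exact Finset.mem_range.2 (hi.2.trans_le (Nat.mul_le_mul_right _ hn))
  have hJ : ∀ i ∈ J, 1 ≤ s i := fun i hi ↦ by
    rw [Finset.mem_Ico] at hi
    simp only [s]
    rw [le_div_iff₀ hk0, one_mul]
    exact_mod_cast hi.1
  have hsum : Real.exp (-θ * 2) ≤ ∑ i ∈ J, w i := by
    have h1 : ∑ i ∈ J, 1 / ((k : ℝ) + 1) * Real.exp (-θ * 2) = Real.exp (-θ * 2) := by
      rw [Finset.sum_const, Nat.card_Ico, nsmul_eq_mul]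
      have : 2 * (k + 1) - (k + 1) = k + 1 := by omega
      rw [this]
      push_cast
      field_simp
    rw [← h1]
    refine Finset.sum_le_sum fun i hi ↦ ?_
    rw [Finset.mem_Ico] at hi
    refine mul_le_mul_of_nonneg_left ?_ (by positivity)
    rw [Real.exp_le_exp]
    have h2 : (i : ℝ) / (k + 1) ≤ 2 := by
      rw [div_le_iff₀ hk0]
      exact_mod_cast hi.2.le
    nlinarith
  have hvar : 1 / 2 * Real.exp (-θ * 2) ^ 2 ≤ 1 / 2 * (∑ i ∈ J, w i) ^ 2 := by gcongr
  have h := measure_abs_lt_le_of_hasGaussianLaw (hB.hasGaussianLaw_sum _ w s hs)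
    (hB.integral_sum_eq_zero _ w s hs) (by positivity)
    (hvar.trans (hB.half_sq_sum_le_integral_sq hH hJI hs hw hJ)) ε
  simpa only [w, s, mul_assoc] using h

/-- The Gaussian variable `∫₀^∞ e^(-θs) B_s ds` has no atom at `0`. -/
theorem IsFractionalBrownianMotion.ae_integral_exp_mul_ne_zero
    (hB : IsFractionalBrownianMotion H B P) (hH : 0 < H) {θ : ℝ} (hθ : 0 < θ)
    (hint : ∀ᵐ ω ∂P, IntegrableOn (fun s ↦ Real.exp (-θ * s) * B s ω) (Set.Ioi 0)) :
    ∀ᵐ ω ∂P, ∫ s in Set.Ioi (0 : ℝ), Real.exp (-θ * s) * B s ω ≠ 0 := by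
  -- Two successive limits with the same constant: Riemann sums to the integral over `[0, n + 2]`,
  -- then `n → ∞`. The shift by `2` keeps `[1, 2]` inside the domain.
  refine ae_ne_zero_of_measure_abs_lt_le fun ε hε ↦ measure_abs_lt_le_of_tendsto
    (Y := fun n ω ↦ ∫ s in (0 : ℝ)..((n + 2 : ℕ) : ℝ), Real.exp (-θ * s) * B s ω)
    (fun n ε hε ↦ measure_abs_lt_le_of_tendsto
      (fun k ε _ ↦ hB.measure_abs_riemannSum_lt_le hH hθ (Nat.le_add_left 2 n) k ε) ?_ hε)
    ?_ hε
  · filter_upwards [hB.continuous_paths] with ω hω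
    refine tendsto_riemannSum (f := fun s ↦ Real.exp (-θ * s) * B s ω) ?_
    exact ContinuousOn.mul (by fun_prop) (hω.mono Set.Icc_subset_Ici_self)
  · filter_upwards [hint] with ω hω
    refine intervalIntegral_tendsto_integral_Ioi 0 hω ?_
    exact tendsto_natCast_atTop_atTop.comp (tendsto_add_atTop_nat 2)

end Nondegeneracy

end FracOU

/-! ### The almost sure statement -/

theorem theorem3p1 {Ω : Type*} [MeasurableSpace Ω] (P : Measure Ω) [IsProbabilityMeasure P]
    (H θ : ℝ) (hH : 1 / 2 < H) (hH' : H < 1) (hθ : 0 < θ)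
    (B X : ℝ → Ω → ℝ)
    (hB : FracOU.IsFractionalBrownianMotion H B P)
    (hX : ∀ᵐ ω ∂P, FracOU.IsOUPath θ (fun t ↦ B t ω) (fun t ↦ X t ω)) :
    ∀ᵐ ω ∂P,
      (∀ t : ℝ, 0 < t →
        -- the estimator is well defined: the Young integral exists, the denominator is positive
        (∃ I : ℝ, FracOU.HasYoungIntegral (fun s ↦ X s ω) (fun s ↦ X s ω) 0 t I) ∧
        IntervalIntegrable (fun s ↦ X s ω ^ 2) volume 0 t ∧
        0 < ∫ s in (0 : ℝ)..t, X s ω ^ 2 ∧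
        FracOU.leastSquaresEstimator (fun s ↦ X s ω) t
          = X t ω ^ 2 / (2 * ∫ s in (0 : ℝ)..t, X s ω ^ 2)) ∧
      Tendsto (fun t : ℝ ↦ FracOU.leastSquaresEstimator (fun s ↦ X s ω) t) atTop (𝓝 θ) := by
  -- `γ < H` makes the paths Hölder of order `γ`; `γ > 1/2` makes the Young integral of `X` against
  -- itself exist.
  obtain ⟨γ, hγ, hγH⟩ := exists_between hH
  have hH0 : 0 < H := by linarith
  have hloc := hB.ae_exists_local_holder (by linarith) hγH
  have hint : ∀ᵐ ω ∂P, IntegrableOn (fun s ↦ Real.exp (-θ * s) * B s ω) (Set.Ioi 0) := by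
    filter_upwards [hloc, hB.continuous_paths, hB.start_zero] with ω ⟨A, hA, h⟩ hc h0
    exact (FracOU.integrableOn_exp_mul_of_cube_growth hθ hc hA fun t ht ↦
      FracOU.abs_le_of_local_holder (by linarith) hA h0 h ht).1
  have hne : ∀ᵐ ω ∂P, ∀ n : ℕ, B (1 / (n + 1)) ω ≠ 0 :=
    ae_all_iff.2 fun n ↦ hB.ae_ne_zero hH0 (by positivity)
  filter_upwards [hX, hloc, hB.continuous_paths, hne,
    hB.ae_integral_exp_mul_ne_zero hH0 hθ hint] with ω hx ⟨A, hA, h⟩ hc hn hξ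
  exact hx.leastSquaresEstimator_spec hθ hγ (by linarith) hA hc h hn hξ
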